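/- Let $n$ candidates arrive in uniformly random order: the absolute ranks $(R_1,\dots,R_n)$ (rank 1 being the best) form a uniformly distributed random permutation of $\{1,\dots,n\}$. Let $X_j=|\{1\le i\le j: R_i\le R_j\}|$ be the relative rank of the $j$-th candidate, let $\mathcal M_n$ be the set of all $\{1,\dots,n\}$-valued stopping rules adapted to the filtration $\mathcal F_j=\sigma(X_1,\dots,X_j)$, and let $$p(k,n)=\sup_{\tau\in\mathcal M_n}P(R_\tau=k)$$ be the maximum probability of selecting the $k$-th best of the $n$ candidates. For $n\ge 3$ put $$b_n=\min\Big\{j\in\{2,\dots,n\}:\ \sum_{i=j+1}^n\frac1{i-2}\le\frac12\Big\},\qquad u_n=(b_n-2)(2n-4)\sum_{i=b_n}^n\frac1{i-2},$$ $$f_n(x)=3x^2-(1+4n)x+(n-2)b_n+2(n+1)+u_n,\qquad a_n=\min\{j\in\{2,\dots,n\}:\ f_n(j)\le0\},$$ and let $$\tau_{3,n}=\min\{a_n\le j\le n:X_j=2\}\wedge\min\{b_n\le j\le n:X_j=3\},\qquad \min\emptyset:=n.$$ Then, as $n\to\infty$, $$\frac{a_n}{n}\to d_1=\frac{2}{2\sqrt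 e+\sqrt{4e-6\sqrt e}}\approx0.466,\qquad \frac{b_n}{n}\to d_2=\frac1{\sqrt e}\approx0.606.$$ Moreover, for every $n\ge 32$ the stopping rule $\tau_{3,n}$ belongs to $\mathcal M_n$ and satisfies $P(R_{\tau_{3,n}}=3)=p(3,n)$, and, as $n\to\infty$, $$p(3,n)\to p(3,\infty)=2d_1^2(1-d_1)=\frac{8\left(2\sqrt e-2+\sqrt{4e-6\sqrt e}\right)}{\left(2\sqrt e+\sqrt{4e-6\sqrt e}\right)^3}\approx0.232,\qquad p(2,n)\to p(2,\infty)=\frac14,$$ and $p(3,\infty)<p(2,\infty)$. (Here $x\approx c$, for $c$ given with three decimals, means $c\le x<c+10^{-3}$.) -/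

import Mathlib

open Filter Topology MeasureTheory ProbabilityTheory

namespace KthBest

/-! ### The selection problem

The candidates are indexed by `j : Fin n` in order of arrival, so `j` is the candidate seen at stage
`j + 1`. An outcome is a permutation `σ` of `Fin n`; all `n!` outcomes are equally likely. -/

/-- Every set of outcomes is an event. -/
instance permMeasurableSpace (n : ℕ) : MeasurableSpace (Equiv.Perm (Fin n)) := ⊤

/-- The uniform probability measure on the `n!` orders of arrival. -/
noncomputable def law (n : ℕ) : Measure (Equiv.Perm (Fin n)) := uniformOn Set.univ

/-- `R_j`: the absolute rank (in `{1, …, n}`, rank 1 being the best) of candidate `j`. -/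
def absRank {n : ℕ} (j : Fin n) (σ : Equiv.Perm (Fin n)) : ℕ := (σ j : ℕ) + 1

/-- `X_j = |{i ≤ j : R_i ≤ R_j}|`: the relative rank of candidate `j` among those seen so far. -/
def relRank {n : ℕ} (j : Fin n) (σ : Equiv.Perm (Fin n)) : ℕ :=
  (Finset.univ.filter fun i : Fin n => i ≤ j ∧ absRank i σ ≤ absRank j σ).card

/-- The filtration generated by the relative ranks: `F_j = σ(X_i : i ≤ j)`. -/
noncomputable def rankFiltration (n : ℕ) :
    Filtration (Fin n) (permMeasurableSpace n) :=
  Filtration.natural (fun j : Fin n => (relRank j : Equiv.Perm (Fin n) → ℕ))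
    (fun _ => Measurable.stronglyMeasurable (fun _ _ => MeasurableSpace.measurableSet_top))

/-- `M_n`: the stopping rules adapted to the relative ranks. A rule always selects one of the `n`
candidates. -/
def stoppingRules (n : ℕ) : Set (Equiv.Perm (Fin n) → Fin n) :=
  {τ | IsStoppingTime (rankFiltration n) (fun σ => (τ σ : WithTop (Fin n)))}

/-- `P(R_τ = k)`: the probability that the rule `τ` selects the `k`-th best candidate. -/
noncomputable def successProb {n : ℕ} (k : ℕ) (τ : Equiv.Perm (Fin n) → Fin n) : ℝ :=
  (law n).real {σ | absRank (τ σ) σ = k}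

/-- `p(k, n) = sup_{τ ∈ M_n} P(R_τ = k)`. -/
noncomputable def p (k n : ℕ) : ℝ := sSup (successProb k '' stoppingRules n)

/-! ### The thresholds and the two-threshold rule (for `n ≥ 3`) -/

/-- `b_n = min {j ∈ {2, …, n} : ∑_{i=j+1}^n 1/(i-2) ≤ 1/2}`. -/
noncomputable def b (n : ℕ) : ℕ :=
  sInf {j : ℕ | 2 ≤ j ∧ j ≤ n ∧ ∑ i ∈ Finset.Icc (j + 1) n, 1 / ((i : ℝ) - 2) ≤ 1 / 2}

/-- `u_n = (b_n - 2)(2n - 4) ∑_{i=b_n}^n 1/(i-2)`. -/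
noncomputable def u (n : ℕ) : ℝ :=
  ((b n : ℝ) - 2) * (2 * (n : ℝ) - 4) * ∑ i ∈ Finset.Icc (b n) n, 1 / ((i : ℝ) - 2)

/-- `f_n(x) = 3x² - (1 + 4n)x + (n - 2)b_n + 2(n + 1) + u_n`. -/
noncomputable def f (n : ℕ) (x : ℝ) : ℝ :=
  3 * x ^ 2 - (1 + 4 * (n : ℝ)) * x + ((n : ℝ) - 2) * (b n : ℝ) + 2 * ((n : ℝ) + 1) + u n

/-- `a_n = min {j ∈ {2, …, n} : f_n(j) ≤ 0}`. -/
noncomputable def a (n : ℕ) : ℕ := sInf {j : ℕ | 2 ≤ j ∧ j ≤ n ∧ f n (j : ℝ) ≤ 0}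

open Classical in
/-- The candidates at which the two-threshold rule is ready to stop: relative rank 2 at a stage
`≥ a_n`, or relative rank 3 at a stage `≥ b_n`. -/
noncomputable def acceptable (n : ℕ) (σ : Equiv.Perm (Fin n)) : Finset (Fin n) :=
  Finset.univ.filter fun j : Fin n =>
    (a n ≤ (j : ℕ) + 1 ∧ relRank j σ = 2) ∨ (b n ≤ (j : ℕ) + 1 ∧ relRank j σ = 3)

/-- `τ_{3,n} = min {a_n ≤ j ≤ n : X_j = 2} ∧ min {b_n ≤ j ≤ n : X_j = 3}`, where the minimum of the
empty set is the last stage. -/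
noncomputable def tau3 (n : ℕ) [NeZero n] (σ : Equiv.Perm (Fin n)) : Fin n :=
  if h : (acceptable n σ).Nonempty then (acceptable n σ).min' h else ⊤

/-! ### The limiting constants -/

/-- `d_1 = 2 / (2√e + √(4e - 6√e))`. -/
noncomputable def d₁ : ℝ :=
  2 / (2 * √(Real.exp 1) + √(4 * Real.exp 1 - 6 * √(Real.exp 1)))

/-- `d_2 = 1/√e`. -/
noncomputable def d₂ : ℝ := 1 / √(Real.exp 1)

end KthBest

/-!
Shifted to start at `0`, the relative ranks of an order of arrival are its Lehmer code, and the code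
is a bijection from permutations to a product of finite intervals. Hence, given the earlier relative
ranks, the next one is uniform (`sum_relRank_eq`). The current rank of a candidate seen earlier is a
function of the relative ranks (`partialRank_succ`), so a candidate that has been selected has a
value `G m y` depending only on the stage `m` and its current rank `y`, and the problem is an
optimal stopping problem solved by backward induction. A pair `(G, V)` that solves the backward
recursions turns every adapted rule into a supermartingale (`sum_stopped_le`). For a rule that stops
only where `V m ≤ G m r` and continues only where `G m r ≤ V m` it is a martingale, and the rule is
optimal (`firstRule_optimal`). It remains to exhibit explicit solutions of the recursions.

For the second best candidate the continuation value is `m(n-m)`, up to scale, in the second half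
and constant before, and `p 2 n` is explicit (`p_two_eq`).

For the third best candidate there are three phases. From stage `b n` on relative ranks `2` and `3`
are both accepted, between `a n` and `b n` only relative rank `2`, and before `a n` nothing. In each
phase the continuation value has a closed form. Rank `3` is worth accepting exactly when the tail
sum `∑_{i>j} 1/(i-2)` is at most `1/2`, and before `b n` rank `2` is worth accepting exactly when
`f n j ≤ 0`. All the inequalities needed (rank `1` is never accepted, rank `2` is always accepted
from `b n` on, `f n` decreases up to `b n`) follow from the logarithmic bounds
`d₂ (n - 1) + 1 ≤ b n < d₂ (n - 2) + 3` as soon as `n ≥ 32`; see `tau3_optimal`.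

The same bounds give `b n / n → d₂`, and they show that `f n x` is
`3x² - 4nx + 2 d₂ n² = 3 (x - d₁ n)(x - (4/3 - d₁) n)` up to an error of order `n`, so the change of
sign at `a n` gives `a n = d₁ n + O(1)`. Finally `p 3 n` lies between the values of relative rank
`2` at stages `a n - 1` and `a n`, both of which tend to `2 d₁² (1 - d₁)`.
-/

namespace KthBest

/-! ### Relative ranks and the uniform law -/

/-- The rank of candidate `j` among the first `m` candidates (meaningful when `j < m`). -/
def partialRank {n : ℕ} (m : ℕ) (j : Fin n) (σ : Equiv.Perm (Fin n)) : ℕ :=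
  (Finset.univ.filter fun i : Fin n => (i : ℕ) < m ∧ σ i ≤ σ j).card

lemma relRank_eq_partialRank {n : ℕ} (j : Fin n) (σ : Equiv.Perm (Fin n)) :
    relRank j σ = partialRank ((j : ℕ) + 1) j σ := by
  refine congrArg Finset.card (Finset.filter_congr fun i _ => ?_)
  rw [absRank, absRank, Fin.le_def, Fin.le_def]
  omega

lemma partialRank_self {n : ℕ} (j : Fin n) (σ : Equiv.Perm (Fin n)) :
    partialRank n j σ = absRank j σ := by
  have h : (Finset.univ.filter fun i : Fin n => (i : ℕ) < n ∧ σ i ≤ σ j)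
      = (Finset.Iic (σ j)).map σ.symm.toEmbedding := by
    ext i
    simp [Finset.mem_map_equiv]
  rw [partialRank, h, Finset.card_map, Fin.card_Iic, absRank]

lemma one_le_partialRank {n m : ℕ} {j : Fin n} (hj : (j : ℕ) < m) (σ : Equiv.Perm (Fin n)) :
    1 ≤ partialRank m j σ :=
  Finset.card_pos.2 ⟨j, by simp [hj]⟩

lemma partialRank_le {n : ℕ} (m : ℕ) (j : Fin n) (σ : Equiv.Perm (Fin n)) :
    partialRank m j σ ≤ m := by
  have : (Finset.univ.filter fun i : Fin n => (i : ℕ) < m ∧ σ i ≤ σ j).card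
      ≤ (Finset.range m).card :=
    Finset.card_le_card_of_injOn (fun i => (i : ℕ)) (fun i hi => by simp_all)
      (fun i _ k _ h => Fin.ext h)
  simpa [partialRank] using this

lemma one_le_relRank {n : ℕ} (j : Fin n) (σ : Equiv.Perm (Fin n)) : 1 ≤ relRank j σ := by
  rw [relRank_eq_partialRank]
  exact one_le_partialRank (Nat.lt_succ_self _) σ

lemma relRank_le {n : ℕ} (j : Fin n) (σ : Equiv.Perm (Fin n)) : relRank j σ ≤ (j : ℕ) + 1 := by
  rw [relRank_eq_partialRank]
  exact partialRank_le _ j σ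

/-- A new candidate `m` pushes an earlier candidate `j` down by one exactly when its relative rank
is at most the current rank of `j`. -/
lemma partialRank_succ {n : ℕ} {j m : Fin n} (hj : j < m) (σ : Equiv.Perm (Fin n)) :
    partialRank ((m : ℕ) + 1) j σ = partialRank m j σ +
      if relRank m σ ≤ partialRank m j σ then 1 else 0 := by
  have hne : σ j ≠ σ m := fun h => hj.ne (σ.injective h)
  by_cases hlt : σ m < σ j
  · have hcond : relRank m σ ≤ partialRank m j σ := by
      rw [relRank_eq_partialRank]
      have hsub : (Finset.univ.filter fun i : Fin n => (i : ℕ) < (m : ℕ) + 1 ∧ σ i ≤ σ m).erase m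
          ⊂ Finset.univ.filter fun i : Fin n => (i : ℕ) < m ∧ σ i ≤ σ j := by
        refine Finset.ssubset_iff_subset_ne.2 ⟨fun i hi => ?_, fun h => ?_⟩
        · simp only [Finset.mem_erase, Finset.mem_filter, Finset.mem_univ, true_and] at hi ⊢
          refine ⟨?_, hi.2.2.trans hlt.le⟩
          have := fun h => hi.1 (Fin.ext h)
          omega
        · have : j ∈ Finset.univ.filter fun i : Fin n => (i : ℕ) < m ∧ σ i ≤ σ j := by
            simpa using hj
          rw [← h] at this
          simp only [Finset.mem_erase, Finset.mem_filter] at this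
          exact absurd this.2.2.2 (not_le.2 hlt)
      have := Finset.card_lt_card hsub
      rw [Finset.card_erase_of_mem (by simp)] at this
      unfold partialRank
      omega
    rw [if_pos hcond, partialRank, partialRank, ← Finset.card_insert_of_notMem (a := m) (by simp)]
    congr 1
    ext i
    simp only [Finset.mem_filter, Finset.mem_univ, true_and, Finset.mem_insert]
    constructor
    · rintro ⟨h1, h2⟩
      by_cases him : i = m
      · exact Or.inl him
      · have := fun h => him (Fin.ext h)
        exact Or.inr ⟨by omega, h2⟩
    · rintro (rfl | ⟨h1, h2⟩)
      · exact ⟨Nat.lt_succ_self _, hlt.le⟩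
      · exact ⟨by omega, h2⟩
  · have hlt' : σ j < σ m := lt_of_le_of_ne (not_lt.1 hlt) hne
    have hcond : ¬ relRank m σ ≤ partialRank m j σ := by
      rw [relRank_eq_partialRank, not_le]
      refine Finset.card_lt_card (Finset.ssubset_iff_subset_ne.2 ⟨fun i hi => ?_, fun h => ?_⟩)
      · simp only [Finset.mem_filter, Finset.mem_univ, true_and] at hi ⊢
        exact ⟨by omega, hi.2.trans hlt'.le⟩
      · have : m ∈ Finset.univ.filter fun i : Fin n => (i : ℕ) < (m : ℕ) + 1 ∧ σ i ≤ σ m := by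
          simp
        rw [← h] at this
        simp at this
    rw [if_neg hcond, add_zero, partialRank, partialRank]
    congr 1
    ext i
    simp only [Finset.mem_filter, Finset.mem_univ, true_and]
    constructor
    · rintro ⟨h1, h2⟩
      refine ⟨?_, h2⟩
      by_contra h3
      have : i = m := Fin.ext (by omega)
      subst this
      exact hlt (lt_of_le_of_ne h2 hne.symm)
    · rintro ⟨h1, h2⟩
      exact ⟨by omega, h2⟩

/-- Two orders of arrival have the same relative ranks at the first `m` candidates. -/
def SameHistory {n : ℕ} (m : ℕ) (σ σ' : Equiv.Perm (Fin n)) : Prop :=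
  ∀ i : Fin n, (i : ℕ) < m → relRank i σ = relRank i σ'

lemma partialRank_congr {n m : ℕ} {σ σ' : Equiv.Perm (Fin n)} (hm : m ≤ n)
    (h : SameHistory m σ σ') {j : Fin n} (hj : (j : ℕ) < m) :
    partialRank m j σ = partialRank m j σ' := by
  induction m with
  | zero => omega
  | succ m ih =>
    have hmn : m < n := hm
    rcases Nat.lt_succ_iff_lt_or_eq.1 hj with hlt | heq
    · have ih' := ih hmn.le (fun i hi => h i (by omega)) hlt
      have e := h ⟨m, hmn⟩ (by simp)
      have s1 := partialRank_succ (m := ⟨m, hmn⟩) (j := j) hlt σ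
      have s2 := partialRank_succ (m := ⟨m, hmn⟩) (j := j) hlt σ'
      simp only at s1 s2
      rw [s1, s2, e, ih']
    · have := h j hj
      rw [relRank_eq_partialRank, relRank_eq_partialRank, heq] at this
      exact this

/-- The sequence of relative ranks, shifted to start at `0`: the Lehmer code of the order of
arrival. -/
def lehmerCode {n : ℕ} (σ : Equiv.Perm (Fin n)) (j : Fin n) : Fin ((j : ℕ) + 1) :=
  ⟨relRank j σ - 1, by have := relRank_le j σ; omega⟩

lemma lehmerCode_val_add_one {n : ℕ} (σ : Equiv.Perm (Fin n)) (j : Fin n) :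
    (lehmerCode σ j : ℕ) + 1 = relRank j σ := by
  have := one_le_relRank j σ
  simp only [lehmerCode]
  omega

lemma lehmerCode_bijective (n : ℕ) : Function.Bijective (lehmerCode (n := n)) := by
  rw [Fintype.bijective_iff_injective_and_card]
  constructor
  · intro σ σ' h
    have hs : SameHistory n σ σ' := fun i _ => by
      rw [← lehmerCode_val_add_one, ← lehmerCode_val_add_one, h]
    ext j
    have := partialRank_congr le_rfl hs j.isLt
    rw [partialRank_self, partialRank_self] at this
    exact Nat.succ_injective this
  · rw [Fintype.card_perm, Fintype.card_fin, Fintype.card_pi]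
    simp only [Fintype.card_fin]
    rw [Fin.prod_univ_eq_prod_range (fun i => i + 1), Finset.prod_range_add_one_eq_factorial]

/-- Resampling one coordinate of a uniformly chosen point of a finite product does not change
its law. -/
lemma sum_sum_update {ι : Type*} [Fintype ι] [DecidableEq ι] {α : ι → Type*}
    [∀ i, Fintype (α i)] (i : ι) (F : (∀ i, α i) → ℝ) :
    ∑ x, ∑ s, F (Function.update x i s) = Fintype.card (α i) * ∑ x, F x := by
  classical
  let e : (∀ i, α i) × α i → (∀ i, α i) × α i := fun z => (Function.update z.1 i z.2, z.1 i)
  have he : Function.Involutive e := fun z => by simp [e]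
  calc ∑ x, ∑ s, F (Function.update x i s) = ∑ z : (∀ i, α i) × α i, F (e z).1 := by
        rw [Fintype.sum_prod_type]
    _ = ∑ z : (∀ i, α i) × α i, F z.1 :=
        Equiv.sum_comp he.toPerm (fun z : (∀ i, α i) × α i => F z.1)
    _ = _ := by
        rw [Fintype.sum_prod_type, Finset.mul_sum]
        simp

/-- Given the earlier relative ranks, the relative rank of candidate `m` is uniform on
`{1, …, m + 1}`. -/
lemma sum_relRank_eq {n : ℕ} (m : Fin n) (F : Equiv.Perm (Fin n) → ℕ → ℝ)
    (hF : ∀ σ σ', SameHistory m σ σ' → F σ = F σ') :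
    ∑ σ, F σ (relRank m σ)
      = ∑ σ, (∑ r ∈ Finset.range ((m : ℕ) + 1), F σ (r + 1)) / ((m : ℝ) + 1) := by
  let c := Equiv.ofBijective _ (lehmerCode_bijective n)
  have hc : ∀ x j, relRank j (c.symm x) = (x j : ℕ) + 1 := fun x j => by
    rw [← lehmerCode_val_add_one]
    exact congrArg (fun y : ∀ j : Fin n, Fin ((j : ℕ) + 1) => (y j : ℕ) + 1)
      (c.apply_symm_apply x)
  have h1 : ∑ σ, F σ (relRank m σ) = ∑ x, F (c.symm x) ((x m : ℕ) + 1) := by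
    rw [← c.symm.sum_comp]
    exact Finset.sum_congr rfl fun x _ => by rw [hc]
  have h2 := sum_sum_update m (fun x => F (c.symm x) ((x m : ℕ) + 1))
  have h3 : ∀ x (s : Fin ((m : ℕ) + 1)), F (c.symm (Function.update x m s)) = F (c.symm x) :=
    fun x s => hF _ _ fun i hi => by
      rw [hc, hc, Function.update_of_ne (fun h => by simp [h] at hi)]
  simp only [h3, Function.update_self, Fintype.card_fin] at h2
  rw [← Finset.sum_div, h1, eq_div_iff (by positivity), mul_comm]
  push_cast at h2
  rw [← h2, ← c.symm.sum_comp]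
  exact Finset.sum_congr rfl fun x _ => Fin.sum_univ_eq_sum_range (fun r => F (c.symm x) (r + 1)) _

/-! ### Stopping rules as non-anticipating rules -/

lemma successProb_eq {n : ℕ} (k : ℕ) (τ : Equiv.Perm (Fin n) → Fin n) :
    successProb k τ
      = (∑ σ, if absRank (τ σ) σ = k then (1 : ℝ) else 0) / (n.factorial : ℝ) := by
  classical
  have : MeasurableSingletonClass (Equiv.Perm (Fin n)) :=
    ⟨fun _ => MeasurableSpace.measurableSet_top⟩
  have hs : {σ | absRank (τ σ) σ = k}
      = ((Finset.univ.filter fun σ => absRank (τ σ) σ = k : Finset _) : Set _) := by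
    ext σ
    simp
  rw [successProb, law, Measure.real, uniformOn_univ, Finset.sum_boole, ENNReal.toReal_div,
    Fintype.card_perm, Fintype.card_fin, hs, Measure.count_apply_finset]
  simp

/-- A rule is non-anticipating if the candidate it selects is determined by the relative ranks
up to and including that candidate. -/
def NonAnticipating {n : ℕ} (τ : Equiv.Perm (Fin n) → Fin n) : Prop :=
  ∀ σ σ', SameHistory ((τ σ : ℕ) + 1) σ σ' → τ σ' = τ σ

lemma SameHistory.symm {n m : ℕ} {σ σ' : Equiv.Perm (Fin n)} (h : SameHistory m σ σ') :
    SameHistory m σ' σ := fun i hi => (h i hi).symm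

lemma SameHistory.mono {n m m' : ℕ} {σ σ' : Equiv.Perm (Fin n)} (h : SameHistory m σ σ')
    (hm : m' ≤ m) : SameHistory m' σ σ' := fun i hi => h i (by omega)

lemma measurableSet_rankFiltration_iff {n : ℕ} (j : Fin n) (s : Set (Equiv.Perm (Fin n))) :
    MeasurableSet[rankFiltration n j] s ↔
      ∀ σ σ', SameHistory ((j : ℕ) + 1) σ σ' → σ ∈ s → σ' ∈ s := by
  constructor
  · intro hs
    let inv : MeasurableSpace (Equiv.Perm (Fin n)) :=
      { MeasurableSet' := fun s => ∀ σ σ', SameHistory ((j : ℕ) + 1) σ σ' → σ ∈ s → σ' ∈ s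
        measurableSet_empty := fun _ _ _ h => h
        measurableSet_compl := fun s hs σ σ' h hσ hσ' => hσ (hs σ' σ h.symm hσ')
        measurableSet_iUnion := fun f hf σ σ' h hσ => by
          obtain ⟨i, hi⟩ := Set.mem_iUnion.1 hσ
          exact Set.mem_iUnion.2 ⟨i, hf i σ σ' h hi⟩ }
    have hle : rankFiltration n j ≤ inv := by
      refine iSup₂_le fun i hi => ?_
      rintro _ ⟨t, -, rfl⟩ σ σ' h hσ
      have : relRank i σ = relRank i σ' := h i (Nat.lt_succ_of_le hi)
      simpa [Set.mem_preimage, ← this] using hσ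
    exact hle s hs
  · intro hs
    have hmeas : ∀ i ≤ j, ∀ c : ℕ, MeasurableSet[rankFiltration n j] {σ | relRank i σ = c} := by
      intro i hi c
      have hle : MeasurableSpace.comap (relRank i : Equiv.Perm (Fin n) → ℕ) inferInstance
          ≤ rankFiltration n j :=
        le_iSup₂_of_le (f := fun (i : Fin n) (_ : i ≤ j) =>
          MeasurableSpace.comap (relRank i : Equiv.Perm (Fin n) → ℕ) inferInstance) i hi le_rfl
      exact hle _ ⟨{c}, MeasurableSet.of_discrete, rfl⟩
    have heq : s = ⋃ σ ∈ s, ⋂ i : Fin n, ⋂ _ : i ≤ j, {σ' | relRank i σ' = relRank i σ} := by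
      ext σ'
      simp only [Set.mem_iUnion, Set.mem_iInter, Set.mem_ofPred_eq, exists_prop]
      constructor
      · exact fun h => ⟨σ', h, fun _ _ => rfl⟩
      · rintro ⟨σ, hσ, h⟩
        exact hs σ σ' (fun i hi => (h i (Fin.le_def.2 (by omega))).symm) hσ
    rw [heq]
    exact MeasurableSet.biUnion (Set.to_countable s) fun σ _ =>
      MeasurableSet.iInter fun i => MeasurableSet.iInter fun hi => hmeas i hi _

lemma mem_stoppingRules_iff {n : ℕ} (τ : Equiv.Perm (Fin n) → Fin n) :
    τ ∈ stoppingRules n ↔ NonAnticipating τ := by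
  have hmem : τ ∈ stoppingRules n ↔
      ∀ j : Fin n, ∀ σ σ', SameHistory ((j : ℕ) + 1) σ σ' → τ σ ≤ j → τ σ' ≤ j := by
    refine forall_congr' fun j => ?_
    rw [measurableSet_rankFiltration_iff]
    simp
  rw [hmem]
  constructor
  · intro h σ σ' hs
    have h1 := h (τ σ) σ σ' hs le_rfl
    exact le_antisymm h1
      (h (τ σ') σ' σ (hs.symm.mono (Nat.succ_le_succ h1)) le_rfl)
  · intro h j σ σ' hs hj
    rw [h σ σ' (hs.mono (Nat.succ_le_succ hj))]
    exact hj

/-! ### Backward induction -/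

lemma sum_range_ite_le (g : ℕ → ℝ) {p M : ℕ} (hp : p ≤ M) :
    ∑ r ∈ Finset.range M, g (p + if r + 1 ≤ p then 1 else 0)
      = p * g (p + 1) + ((M : ℝ) - p) * g p := by
  obtain ⟨q, rfl⟩ := Nat.exists_eq_add_of_le hp
  rw [Finset.sum_range_add]
  have h1 : ∀ r ∈ Finset.range p, g (p + if r + 1 ≤ p then 1 else 0) = g (p + 1) :=
    fun r hr => by rw [if_pos (Nat.succ_le_of_lt (Finset.mem_range.1 hr))]
  have h2 : ∀ r ∈ Finset.range q, g (p + if p + r + 1 ≤ p then 1 else 0) = g p :=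
    fun r _ => by rw [if_neg (by omega), add_zero]
  rw [Finset.sum_congr rfl h1, Finset.sum_congr rfl h2]
  simp

/-- The supermartingale bound. Here `G m y` is the value of having selected a candidate whose rank
among the first `m` is `y`, `V m` bounds the value of having selected none of the first `m`, and
`W m r` bounds the value, after seeing relative rank `r` at the next candidate, of the decision
taken by `τ`. -/
lemma sum_stopped_le {n : ℕ} {τ : Equiv.Perm (Fin n) → Fin n} (hτ : NonAnticipating τ)
    (G : ℕ → ℕ → ℝ) (V : ℕ → ℝ) (W : ℕ → ℕ → ℝ)
    (hG : ∀ m < n, ∀ y, 1 ≤ y → y ≤ m →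
      ((m : ℝ) + 1) * G m y = y * G (m + 1) (y + 1) + ((m : ℝ) + 1 - y) * G (m + 1) y)
    (hW : ∀ (m : Fin n) σ, m ≤ τ σ →
      (if τ σ = m then G (m + 1) (relRank m σ) else V (m + 1)) ≤ W m (relRank m σ))
    (hV : ∀ m < n, ∑ r ∈ Finset.range (m + 1), W m (r + 1) ≤ ((m : ℝ) + 1) * V m) :
    ∑ σ, G n (absRank (τ σ) σ) ≤ n.factorial * V 0 := by
  -- the value process of the rule after `m` candidates
  let Φ : ℕ → Equiv.Perm (Fin n) → ℝ := fun m σ =>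
    if (τ σ : ℕ) < m then G m (partialRank m (τ σ) σ) else V m
  have hstep : ∀ m < n, ∑ σ, Φ (m + 1) σ ≤ ∑ σ, Φ m σ := by
    intro m hm
    let M : Fin n := ⟨m, hm⟩
    let F : Equiv.Perm (Fin n) → ℕ → ℝ := fun σ r =>
      if (τ σ : ℕ) < m then
        G (m + 1) (partialRank m (τ σ) σ + if r ≤ partialRank m (τ σ) σ then 1 else 0)
      else W m r
    have hF : ∀ σ σ', SameHistory m σ σ' → F σ = F σ' := by
      intro σ σ' h
      by_cases hlt : (τ σ : ℕ) < m
      · have e := hτ σ σ' (h.mono hlt)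
        have ep := partialRank_congr hm.le h hlt
        funext r
        simp only [F, e, ep]
      · have hlt' : ¬ (τ σ' : ℕ) < m := fun h' => hlt (hτ σ' σ (h.symm.mono h') ▸ h')
        funext r
        simp only [F, if_neg hlt, if_neg hlt']
    have h1 : ∀ σ, Φ (m + 1) σ ≤ F σ (relRank M σ) := by
      intro σ
      by_cases hlt : (τ σ : ℕ) < m
      · have s := partialRank_succ (j := τ σ) (m := M) hlt σ
        simp only [Φ, F, if_pos hlt, if_pos (Nat.lt_succ_of_lt hlt)]
        rw [show partialRank (m + 1) (τ σ) σ = _ from s]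
      · have hle : M ≤ τ σ := Fin.le_def.2 (not_lt.1 hlt)
        have hw := hW M σ hle
        simp only [F, if_neg hlt]
        refine le_trans (le_of_eq ?_) hw
        by_cases heq : τ σ = M
        · have : (τ σ : ℕ) < m + 1 := by rw [heq]; exact Nat.lt_succ_self m
          simp only [Φ, if_pos this, if_pos heq]
          rw [heq, relRank_eq_partialRank]
        · have : ¬ (τ σ : ℕ) < m + 1 := fun h => heq (Fin.ext (by simp only [M]; omega))
          simp only [Φ, if_neg this, if_neg heq, M]
    refine (Finset.sum_le_sum fun σ _ => h1 σ).trans ?_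
    rw [sum_relRank_eq M F hF]
    refine Finset.sum_le_sum fun σ _ => ?_
    rw [div_le_iff₀ (by positivity)]
    by_cases hlt : (τ σ : ℕ) < m
    · simp only [F, Φ, if_pos hlt, M]
      rw [sum_range_ite_le (G (m + 1)) ((partialRank_le m _ σ).trans m.le_succ), mul_comm (G m _),
        hG m hm _ (one_le_partialRank hlt σ) (partialRank_le m _ σ)]
      push_cast
      exact le_rfl
    · simp only [F, Φ, if_neg hlt, M]
      rw [mul_comm (V m)]
      exact hV m hm
  have hall : ∀ m ≤ n, ∑ σ, Φ m σ ≤ ∑ σ, Φ 0 σ := by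
    intro m
    induction m with
    | zero => exact fun _ => le_rfl
    | succ m ih => exact fun hm => (hstep m hm).trans (ih (Nat.le_of_succ_le hm))
  have h := hall n le_rfl
  simpa [Φ, partialRank_self, Fintype.card_perm] using h

open Classical in
/-- The candidates that are acceptable when relative rank `r` at stage `j` is accepted if and only
if `A j r`. -/
noncomputable def readySet (A : ℕ → ℕ → Prop) {n : ℕ} (σ : Equiv.Perm (Fin n)) : Finset (Fin n) :=
  Finset.univ.filter fun j : Fin n => A ((j : ℕ) + 1) (relRank j σ)

open Classical in
/-- The rule that selects the first acceptable candidate, and the last candidate if there is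
none. -/
noncomputable def firstRule (A : ℕ → ℕ → Prop) (n : ℕ) [NeZero n] (σ : Equiv.Perm (Fin n)) :
    Fin n :=
  if h : (readySet A σ).Nonempty then (readySet A σ).min' h else ⊤

lemma mem_readySet {A : ℕ → ℕ → Prop} {n : ℕ} {σ : Equiv.Perm (Fin n)} {j : Fin n} :
    j ∈ readySet A σ ↔ A ((j : ℕ) + 1) (relRank j σ) := by
  simp [readySet]

section firstRule

variable {A : ℕ → ℕ → Prop} {n : ℕ} [NeZero n] {σ : Equiv.Perm (Fin n)}

lemma firstRule_le {j : Fin n} (hj : A ((j : ℕ) + 1) (relRank j σ)) : firstRule A n σ ≤ j := by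
  have hm := mem_readySet.2 hj
  rw [firstRule, dif_pos ⟨j, hm⟩]
  exact Finset.min'_le _ _ hm

lemma accepted_or_eq_top : A ((firstRule A n σ : ℕ) + 1) (relRank (firstRule A n σ) σ) ∨
    firstRule A n σ = ⊤ := by
  by_cases h : (readySet A σ).Nonempty
  · left
    rw [firstRule, dif_pos h]
    exact mem_readySet.1 (Finset.min'_mem _ h)
  · right
    rw [firstRule, dif_neg h]

lemma nonAnticipating_firstRule : NonAnticipating (firstRule A n) := by
  intro σ σ' h
  have hle : firstRule A n σ' ≤ firstRule A n σ := by
    rcases accepted_or_eq_top (A := A) (σ := σ) with hacc | htop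
    · rw [h _ (Nat.lt_succ_self _)] at hacc
      exact firstRule_le hacc
    · rw [htop]
      exact le_top
  refine le_antisymm hle ?_
  rcases accepted_or_eq_top (A := A) (σ := σ') with hacc | htop
  · rw [← h _ (Nat.lt_succ_of_le hle)] at hacc
    exact firstRule_le hacc
  · rw [htop]
    exact le_top

open Classical in
/-- Verification: if `G` and `V` solve the backward recursions and `A` accepts exactly where
stopping is at least as good as continuing, then the first-acceptance rule of `A` is optimal, and
`V 0` is the optimal value. The functions may carry a common scale `c`. -/
theorem firstRule_optimal (k : ℕ) {c : ℝ} (hc : 0 < c) (G : ℕ → ℕ → ℝ) (V : ℕ → ℝ)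
    (hG : ∀ m < n, ∀ y, 1 ≤ y → y ≤ m →
      ((m : ℝ) + 1) * G m y = y * G (m + 1) (y + 1) + ((m : ℝ) + 1 - y) * G (m + 1) y)
    (hGn : ∀ y, 1 ≤ y → y ≤ n → G n y = if y = k then c else 0) (hVn : V n = 0)
    (hV : ∀ m < n, ((m : ℝ) + 1) * V m = ∑ r ∈ Finset.range (m + 1),
      if A (m + 1) (r + 1) then G (m + 1) (r + 1) else V (m + 1))
    (hA : ∀ m r, 1 ≤ r → r ≤ m → m ≤ n → A m r → V m ≤ G m r)
    (hA' : ∀ m r, 1 ≤ r → r ≤ m → m ≤ n → ¬ A m r → G m r ≤ V m) :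
    firstRule A n ∈ stoppingRules n ∧ successProb k (firstRule A n) = p k n ∧
      p k n = V 0 / c := by
  let W : ℕ → ℕ → ℝ := fun m r => if A (m + 1) r then G (m + 1) r else V (m + 1)
  have hfac : (0 : ℝ) < n.factorial := by exact_mod_cast n.factorial_pos
  have hsum : ∀ τ : Equiv.Perm (Fin n) → Fin n,
      successProb k τ = (∑ σ, G n (absRank (τ σ) σ)) / n.factorial / c := by
    intro τ
    rw [successProb_eq, div_right_comm]
    congr 1
    rw [eq_div_iff hc.ne', Finset.sum_mul]
    refine Finset.sum_congr rfl fun σ _ => ?_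
    rw [hGn (absRank (τ σ) σ) (Nat.succ_pos _) (σ (τ σ)).isLt, ite_mul, one_mul, zero_mul]
  have hupper : ∀ τ ∈ stoppingRules n, successProb k τ ≤ V 0 / c := by
    intro τ hτ
    rw [hsum, div_le_div_iff_of_pos_right hc, div_le_iff₀' hfac]
    refine sum_stopped_le ((mem_stoppingRules_iff τ).1 hτ) G V W hG (fun m σ _ => ?_)
      fun m hm => (hV m hm).ge
    have h1 := one_le_relRank m σ
    have h2 := relRank_le m σ
    by_cases hacc : A (m + 1) (relRank m σ)
    · have := hA _ _ h1 h2 m.isLt hacc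
      simp only [W, if_pos hacc]
      split_ifs
      · exact le_rfl
      · exact this
    · have := hA' _ _ h1 h2 m.isLt hacc
      simp only [W, if_neg hacc]
      split_ifs
      · exact this
      · exact le_rfl
  have hna : NonAnticipating (firstRule A n) := nonAnticipating_firstRule
  have hmem : firstRule A n ∈ stoppingRules n := (mem_stoppingRules_iff _).2 hna
  have hlower : V 0 / c ≤ successProb k (firstRule A n) := by
    rw [hsum, div_le_div_iff_of_pos_right hc, le_div_iff₀' hfac]
    -- for this rule the decision is the one that attains `W`, so the bound applies to `-G`, `-V`
    have := sum_stopped_le hna (fun m y => -G m y) (fun m => -V m) (fun m r => -W m r)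
      (fun m hm y h1 h2 => by have := hG m hm y h1 h2; linarith) (fun m σ hle => ?_)
      (fun m hm => by rw [Finset.sum_neg_distrib, ← hV m hm]; linarith)
    · simp only [Finset.sum_neg_distrib] at this
      linarith
    · have h1 := one_le_relRank m σ
      have h2 := relRank_le m σ
      by_cases hacc : A (m + 1) (relRank m σ)
      · simp only [W, if_pos hacc]
        rw [if_pos (le_antisymm (firstRule_le hacc) hle)]
      · simp only [W, if_neg hacc]
        split_ifs with heq
        · have htop : (m : ℕ) + 1 = n := by
            rcases accepted_or_eq_top (A := A) (σ := σ) with h | h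
            · rw [heq] at h
              exact absurd h hacc
            · rw [heq] at h
              obtain ⟨l, rfl⟩ := Nat.exists_eq_succ_of_ne_zero (NeZero.ne n)
              rw [h]
              rfl
          have hle0 := hA' _ _ h1 h2 m.isLt hacc
          rw [htop] at h2 hle0 ⊢
          have hg := hGn _ h1 h2
          rw [hVn] at hle0 ⊢
          have : 0 ≤ G n (relRank m σ) := by
            rw [hg]
            split_ifs <;> linarith
          linarith
        · exact le_rfl
  have hval : successProb k (firstRule A n) = V 0 / c := le_antisymm (hupper _ hmem) hlower
  have hp : p k n = V 0 / c := by
    refine IsGreatest.csSup_eq ⟨⟨_, hmem, hval⟩, ?_⟩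
    rintro _ ⟨τ, hτ, rfl⟩
    exact hupper τ hτ
  exact ⟨hmem, hval.trans hp.symm, hp⟩

end firstRule

lemma tau3_eq_firstRule (n : ℕ) [NeZero n] :
    tau3 n = firstRule (fun j r => (a n ≤ j ∧ r = 2) ∨ (b n ≤ j ∧ r = 3)) n := by
  have h : ∀ σ, acceptable n σ
      = readySet (fun j r => (a n ≤ j ∧ r = 2) ∨ (b n ≤ j ∧ r = 3)) σ := fun σ => by
    ext j
    simp [acceptable, readySet]
  funext σ
  simp only [tau3, firstRule, h]

open Classical in
/-- The backward recursion for a rule that accepts relative rank `2` if `P` holds and relative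
rank `3` if `Q` holds. -/
lemma sum_range_accept {A : ℕ → Prop} {P Q : Prop}
    (hA : ∀ r, A r ↔ (P ∧ r = 2) ∨ (Q ∧ r = 3)) (g : ℕ → ℝ) (v : ℝ) {M : ℕ} (hP : P → 2 ≤ M)
    (hQ : Q → 3 ≤ M) :
    ∑ r ∈ Finset.range M, (if A (r + 1) then g (r + 1) else v)
      = M * v + (if P then g 2 - v else 0) + if Q then g 3 - v else 0 := by
  have h : ∀ r, (if A (r + 1) then g (r + 1) else v)
      = v + (if r = 1 then if P then g 2 - v else 0 else 0)
        + if r = 2 then if Q then g 3 - v else 0 else 0 := by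
    intro r
    by_cases h1 : r = 1
    · subst h1
      by_cases hp : P <;> simp [hA, hp]
    · by_cases h2 : r = 2
      · subst h2
        by_cases hq : Q <;> simp [hA, hq]
      · simp [hA, h1, h2]
  simp only [h, Finset.sum_add_distrib, Finset.sum_ite_eq', Finset.mem_range, Finset.sum_const,
    Finset.card_range, nsmul_eq_mul]
  congr 1
  · congr 1
    by_cases hp : P
    · simp [hp, Nat.lt_of_succ_le (hP hp)]
    · simp [hp]
  · by_cases hq : Q
    · simp [hq, Nat.lt_of_succ_le (hQ hq)]
    · simp [hq]

/-! ### Selecting the second best candidate -/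

/-- `n(n-1)` times the probability that a candidate whose rank among the first `m` is `y` is the
second best of all. -/
def secondValue (n m : ℕ) : ℕ → ℝ
  | 1 => (m : ℝ) * (n - m)
  | 2 => (m : ℝ) * (m - 1)
  | _ => 0

/-- `n(n-1)` times the optimal probability of selecting the second best candidate, once the first
`m` candidates have been passed over. -/
noncomputable def secondCont (n m : ℕ) : ℝ :=
  if m ≤ n / 2 then ((n / 2 : ℕ) : ℝ) * (n - (n / 2 : ℕ)) else (m : ℝ) * (n - m)

/-- It is optimal to select the first candidate of relative rank `2` in the second half. -/
lemma p_two_eq {n : ℕ} (hn : 2 ≤ n) :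
    p 2 n = ((n / 2 : ℕ) : ℝ) * (n - (n / 2 : ℕ)) / (n * (n - 1)) := by
  classical
  have : NeZero n := ⟨by omega⟩
  have hn' : (2 : ℝ) ≤ n := by exact_mod_cast hn
  obtain ⟨h, hh⟩ : ∃ h, h = n / 2 := ⟨_, rfl⟩
  have hlo : 2 * h ≤ n := by omega
  have hhi : n ≤ 2 * h + 1 := by omega
  have hlo' : 2 * (h : ℝ) ≤ n := by exact_mod_cast hlo
  have hhi' : (n : ℝ) ≤ 2 * h + 1 := by exact_mod_cast hhi
  have key := firstRule_optimal (A := fun j r => (n < 2 * j ∧ r = 2) ∨ (False ∧ r = 3)) (n := n) 2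
    (c := n * (n - 1)) (by nlinarith) (secondValue n) (secondCont n) ?_ ?_ ?_ ?_ ?_ ?_
  · rw [key.2.2, secondCont, if_pos (Nat.zero_le _)]
  · rintro m - y h1 -
    rcases y with _ | _ | _ | y
    · omega
    all_goals simp only [secondValue]; push_cast; ring
  · rintro y h1 -
    rcases y with _ | _ | _ | y
    · omega
    all_goals simp [secondValue]
  · rw [secondCont, if_neg (by omega)]
    ring
  · intro m hm
    refine Eq.trans ?_ (sum_range_accept (fun _ => Iff.rfl) (secondValue n (m + 1))
      (secondCont n (m + 1)) (M := m + 1) (by omega) False.elim).symm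
    rw [if_neg (c := False) id]
    simp only [secondCont, secondValue, ← hh]
    by_cases h2 : n < 2 * (m + 1)
    · rw [if_pos h2, if_neg (by omega : ¬ m + 1 ≤ h)]
      split_ifs with h3
      · have : h = m := by omega
        subst this
        push_cast
        ring
      · push_cast
        ring
    · rw [if_neg h2, if_pos (by omega : m + 1 ≤ h), if_pos (by omega : m ≤ h)]
      push_cast
      ring
  · rintro m r h1 h2 h3 (⟨h4, rfl⟩ | ⟨hf, -⟩)
    · have h4' : (n : ℝ) + 1 ≤ 2 * m := by exact_mod_cast h4
      rw [secondCont, if_neg (by omega)]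
      simp only [secondValue]
      nlinarith
    · exact hf.elim
  · intro m r h1 h2 h3 h4
    have hm1 : (m : ℝ) ≤ n := by exact_mod_cast h3
    have hm0 : (0 : ℝ) ≤ m := m.cast_nonneg
    have hbase : (m : ℝ) * (n - m) ≤ secondCont n m := by
      rw [secondCont, ← hh]
      split_ifs with h5
      · have : (m : ℝ) ≤ h := by exact_mod_cast h5
        nlinarith
      · exact le_rfl
    rcases r with _ | _ | _ | r
    · omega
    · exact hbase
    · refine le_trans ?_ hbase
      have h4' : 2 * m ≤ n := by
        by_contra hc
        exact h4 (Or.inl ⟨by omega, rfl⟩)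
      have : 2 * (m : ℝ) ≤ n := by exact_mod_cast h4'
      simp only [secondValue]
      nlinarith
    · refine le_trans ?_ hbase
      simp only [secondValue]
      exact mul_nonneg hm0 (by linarith)

lemma tendsto_p_two : Tendsto (fun n : ℕ => p 2 n) atTop (𝓝 (1 / 4)) := by
  have hone : Tendsto (fun n : ℕ => 1 / ((n : ℝ) - 1)) atTop (𝓝 0) :=
    (tendsto_const_nhds.div_atTop
      (tendsto_atTop_add_const_right _ (-1) tendsto_natCast_atTop_atTop))
  -- the product of the two halves of `n` lies between `(n² - 1) / 4` and `n² / 4`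
  have hhi : Tendsto (fun n : ℕ => 1 / 4 + 1 / 4 * (1 / ((n : ℝ) - 1))) atTop (𝓝 (1 / 4)) := by
    simpa only [mul_zero, add_zero] using (hone.const_mul (1 / 4)).const_add (1 / 4 : ℝ)
  refine tendsto_of_tendsto_of_tendsto_of_le_of_le' tendsto_const_nhds hhi ?_ ?_
  all_goals
    filter_upwards [eventually_ge_atTop 2] with n hn
    have hn' : (2 : ℝ) ≤ n := by exact_mod_cast hn
    have hpos : (0 : ℝ) < n * (n - 1) := by nlinarith
    have hlo' : 2 * ((n / 2 : ℕ) : ℝ) ≤ n := by exact_mod_cast Nat.mul_div_le n 2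
    have hhi' : (n : ℝ) ≤ 2 * ((n / 2 : ℕ) : ℝ) + 1 := by
      have : n ≤ 2 * (n / 2) + 1 := by omega
      exact_mod_cast this
    rw [p_two_eq hn]
  · rw [le_div_iff₀ hpos]
    nlinarith
  · rw [div_le_iff₀ hpos]
    have : (1 / 4 + 1 / 4 * (1 / ((n : ℝ) - 1))) * (n * (n - 1)) = n ^ 2 / 4 := by
      have : (n : ℝ) - 1 ≠ 0 := by linarith
      field_simp
      ring
    rw [this]
    nlinarith [sq_nonneg ((n : ℝ) - 2 * ((n / 2 : ℕ) : ℝ))]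

/-! ### The thresholds -/

/-- The sum `∑_{i=j+1}^n 1/(i-2)` that governs the acceptance of relative rank `3`. -/
noncomputable def tailSum (n j : ℕ) : ℝ := ∑ i ∈ Finset.Icc (j + 1) n, 1 / ((i : ℝ) - 2)

lemma tailSum_self (n : ℕ) : tailSum n n = 0 := by simp [tailSum]

lemma tailSum_eq_add {n j : ℕ} (h : j < n) :
    tailSum n j = 1 / ((j : ℝ) - 1) + tailSum n (j + 1) := by
  have hins : Finset.Icc (j + 1) n = insert (j + 1) (Finset.Icc (j + 1 + 1) n) := by
    ext i
    simp only [Finset.mem_Icc, Finset.mem_insert]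
    omega
  rw [tailSum, tailSum, hins, Finset.sum_insert (by simp)]
  congr 2
  push_cast
  ring

lemma tailSum_le_of_le {n i j : ℕ} (hi : 2 ≤ i) (hij : i ≤ j) : tailSum n j ≤ tailSum n i := by
  refine Finset.sum_le_sum_of_subset_of_nonneg (Finset.Icc_subset_Icc_left (by omega))
    fun l hl _ => ?_
  have : (3 : ℝ) ≤ l := by
    have := (Finset.mem_Icc.1 hl).1
    exact_mod_cast (by omega : 3 ≤ l)
  exact one_div_nonneg.2 (by linarith)

/-- A lower bound for the tail sums follows from one for each summand. -/
lemma le_tailSum {n : ℕ} (φ : ℕ → ℝ) (hn : φ n ≤ 0) {j₀ : ℕ}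
    (h : ∀ j, j₀ ≤ j → j < n → φ j - φ (j + 1) ≤ 1 / ((j : ℝ) - 1)) {j : ℕ} (hj : j₀ ≤ j)
    (hjn : j ≤ n) : φ j ≤ tailSum n j := by
  induction hjn using Nat.decreasingInduction with
  | self => rwa [tailSum_self]
  | of_succ l hl ih =>
    have h1 := ih (by omega)
    have h2 := h l hj hl
    rw [tailSum_eq_add hl]
    linarith

lemma tailSum_le {n : ℕ} (φ : ℕ → ℝ) (hn : 0 ≤ φ n) {j₀ : ℕ}
    (h : ∀ j, j₀ ≤ j → j < n → 1 / ((j : ℝ) - 1) ≤ φ j - φ (j + 1)) {j : ℕ} (hj : j₀ ≤ j)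
    (hjn : j ≤ n) : tailSum n j ≤ φ j := by
  induction hjn using Nat.decreasingInduction with
  | self => rwa [tailSum_self]
  | of_succ l hl ih =>
    have h1 := ih (by omega)
    have h2 := h l hj hl
    rw [tailSum_eq_add hl]
    linarith

lemma log_le_tailSum {n j : ℕ} (hj : 2 ≤ j) (hjn : j ≤ n) :
    Real.log ((n - 1) / (j - 1)) ≤ tailSum n j := by
  refine le_tailSum (fun j => Real.log (((n : ℝ) - 1) / (j - 1))) ?_ (j₀ := 2)
    (fun i hi hin => ?_) hj hjn
  · have : (n : ℝ) - 1 ≠ 0 := by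
      have : (2 : ℝ) ≤ n := by exact_mod_cast hj.trans hjn
      linarith
    simp [div_self this]
  · have h1 : (2 : ℝ) ≤ i := by exact_mod_cast hi
    have h2 : (i : ℝ) + 1 ≤ n := by exact_mod_cast hin
    push_cast
    rw [← Real.log_div (by apply ne_of_gt; apply div_pos <;> linarith)
      (by apply ne_of_gt; apply div_pos <;> linarith)]
    refine (Real.log_le_sub_one_of_pos (by
      apply div_pos <;> apply div_pos <;> linarith)).trans (le_of_eq ?_)
    have h3 : (n : ℝ) - 1 ≠ 0 := by linarith
    have h4 : (i : ℝ) - 1 ≠ 0 := by linarith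
    field_simp
    ring

lemma tailSum_le_log {n j : ℕ} (hj : 3 ≤ j) (hjn : j ≤ n) :
    tailSum n j ≤ Real.log ((n - 2) / (j - 2)) := by
  refine tailSum_le (fun j => Real.log (((n : ℝ) - 2) / (j - 2))) ?_ (j₀ := 3)
    (fun i hi hin => ?_) hj hjn
  · have : (n : ℝ) - 2 ≠ 0 := by
      have : (3 : ℝ) ≤ n := by exact_mod_cast hj.trans hjn
      linarith
    simp [div_self this]
  · have h1 : (3 : ℝ) ≤ i := by exact_mod_cast hi
    have h2 : (i : ℝ) + 1 ≤ n := by exact_mod_cast hin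
    push_cast
    rw [← neg_le_neg_iff, neg_sub,
      ← Real.log_div (by apply ne_of_gt; apply div_pos <;> linarith)
      (by apply ne_of_gt; apply div_pos <;> linarith)]
    refine (Real.log_le_sub_one_of_pos (by
      apply div_pos <;> apply div_pos <;> linarith)).trans (le_of_eq ?_)
    have h3 : (n : ℝ) - 2 ≠ 0 := by linarith
    have h4 : (i : ℝ) - 1 ≠ 0 := by linarith
    have h5 : (i : ℝ) - 2 ≠ 0 := by linarith
    have h6 : (i : ℝ) + 1 - 2 ≠ 0 := by linarith
    field_simp
    ring

lemma div_le_tailSum {n j : ℕ} (hj : 2 ≤ j) (hjn : j ≤ n) :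
    ((n : ℝ) - j) / (n - 2) ≤ tailSum n j := by
  refine le_tailSum (fun j => ((n : ℝ) - j) / (n - 2)) (by simp) (j₀ := 2)
    (fun i hi hin => ?_) hj hjn
  have h1 : (2 : ℝ) ≤ i := by exact_mod_cast hi
  have h2 : (i : ℝ) + 1 ≤ n := by exact_mod_cast hin
  push_cast
  rw [← sub_div, div_le_div_iff₀ (by linarith) (by linarith)]
  linarith

lemma tailSum_le_div {n j : ℕ} (hj : 2 ≤ j) (hjn : j ≤ n) :
    tailSum n j ≤ ((n : ℝ) - j) / (j - 1) := by
  have h0 : (2 : ℝ) ≤ j := by exact_mod_cast hj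
  refine tailSum_le (fun i => ((n : ℝ) - i) / (j - 1)) (by simp) (j₀ := j)
    (fun i hi hin => ?_) le_rfl hjn
  have h1 : (j : ℝ) ≤ i := by exact_mod_cast hi
  push_cast
  rw [← sub_div, div_le_div_iff₀ (by linarith) (by linarith)]
  linarith

lemma b_mem {n : ℕ} (hn : 2 ≤ n) : 2 ≤ b n ∧ b n ≤ n ∧ tailSum n (b n) ≤ 1 / 2 := by
  have : b n ∈ {j : ℕ | 2 ≤ j ∧ j ≤ n ∧ tailSum n j ≤ 1 / 2} :=
    Nat.sInf_mem ⟨n, hn, le_rfl, by rw [tailSum_self]; norm_num⟩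
  exact this

lemma half_lt_tailSum {n j : ℕ} (hn : 2 ≤ n) (hj : 2 ≤ j) (hjb : j < b n) :
    1 / 2 < tailSum n j := by
  by_contra h
  have hmem : j ∈ {j : ℕ | 2 ≤ j ∧ j ≤ n ∧ tailSum n j ≤ 1 / 2} :=
    ⟨hj, hjb.le.trans (b_mem hn).2.1, not_lt.1 h⟩
  exact absurd (Nat.sInf_le hmem) (not_le.2 hjb)

lemma d₂_eq_exp : d₂ = Real.exp (-(1 / 2)) := by
  rw [d₂, Real.exp_neg, ← Real.exp_half, one_div]

lemma le_b {n : ℕ} (hn : 2 ≤ n) : d₂ * ((n : ℝ) - 1) ≤ b n - 1 := by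
  obtain ⟨h1, h2, h3⟩ := b_mem hn
  have hn' : (2 : ℝ) ≤ n := by exact_mod_cast hn
  have h1' : (2 : ℝ) ≤ b n := by exact_mod_cast h1
  have h := (log_le_tailSum h1 h2).trans h3
  rw [Real.log_le_iff_le_exp (div_pos (by linarith) (by linarith)),
    div_le_iff₀ (by linarith)] at h
  calc d₂ * ((n : ℝ) - 1) ≤ d₂ * (Real.exp (1 / 2) * (b n - 1)) :=
        mul_le_mul_of_nonneg_left h (by rw [d₂_eq_exp]; positivity)
    _ = b n - 1 := by rw [d₂_eq_exp, ← mul_assoc, ← Real.exp_add]; simp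

lemma b_lt {n : ℕ} (hn : 3 ≤ n) : (b n : ℝ) - 3 < d₂ * (n - 2) := by
  have hn' : (3 : ℝ) ≤ n := by exact_mod_cast hn
  have hd : 0 < d₂ := by rw [d₂_eq_exp]; positivity
  by_cases hb : b n ≤ 3
  · have : (b n : ℝ) ≤ 3 := by exact_mod_cast hb
    nlinarith
  · obtain ⟨c, hc⟩ : ∃ c, b n = c + 1 := ⟨b n - 1, by omega⟩
    obtain ⟨-, h2, -⟩ := b_mem (n := n) (by omega)
    have hc3 : (3 : ℝ) ≤ c := by exact_mod_cast (by omega : 3 ≤ c)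
    have h := (half_lt_tailSum (n := n) (j := c) (by omega) (by omega) (by omega)).trans_le
      (tailSum_le_log (by omega) (by omega))
    rw [Real.lt_log_iff_exp_lt (div_pos (by linarith) (by linarith)),
      lt_div_iff₀ (by linarith)] at h
    calc (b n : ℝ) - 3 = d₂ * (Real.exp (1 / 2) * (c - 2)) := by
          rw [d₂_eq_exp, ← mul_assoc, ← Real.exp_add, hc]
          push_cast
          simp
          ring
      _ < _ := mul_lt_mul_of_pos_left h hd

lemma sqrt_exp_one_bounds : 1.6487 < √(Real.exp 1) ∧ √(Real.exp 1) < 1.6488 := by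
  constructor
  · exact Real.lt_sqrt_of_sq_lt (by have := Real.exp_one_gt_d9; norm_num; linarith)
  · rw [Real.sqrt_lt' (by norm_num)]
    have := Real.exp_one_lt_d9
    norm_num
    linarith

lemma d₂_bounds : 0.606 ≤ d₂ ∧ d₂ < 0.607 := by
  obtain ⟨h1, h2⟩ := sqrt_exp_one_bounds
  rw [d₂]
  constructor
  · rw [le_div_iff₀ (by linarith)]
    linarith
  · rw [div_lt_iff₀ (by linarith)]
    linarith

/-! ### Selecting the third best candidate -/

/-- `n(n-1)(n-2)` times the probability that a candidate whose rank among the first `m` is `y` is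
the third best of all. -/
def thirdValue (n m : ℕ) : ℕ → ℝ
  | 1 => (m : ℝ) * (n - m) * (n - m - 1)
  | 2 => 2 * (m : ℝ) * (m - 1) * (n - m)
  | 3 => (m : ℝ) * (m - 1) * (m - 2)
  | _ => 0

/-- The continuation value from stage `m` on when relative ranks `2` and `3` are both accepted. -/
noncomputable def lateCont (n m : ℕ) : ℝ :=
  (m : ℝ) * (m - 1) * ((2 * n - 4) * tailSum n m - (n - m))

/-- The continuation value from a stage `m < b n` on when relative rank `2` is accepted at once
and relative rank `3` from stage `b n` on. -/
noncomputable def midCont (n m : ℕ) : ℝ :=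
  (m : ℝ) * (u n - (b n - 2) * (n - b n + 1) + 2 * n * (b n - 1 - m) - b n * (b n - 1)
    + m * (m + 1))

/-- `n(n-1)(n-2)` times the optimal probability of selecting the third best candidate, once the
first `m` candidates have been passed over. -/
noncomputable def thirdCont (n m : ℕ) : ℝ :=
  if b n ≤ m + 1 then lateCont n m
  else if a n ≤ m + 1 then midCont n m
  else midCont n (a n - 1)

/-- Accepting relative rank `2` at stage `m` beats continuing exactly when `f n m ≤ 0`. -/
lemma midCont_eq (n m : ℕ) : midCont n m = thirdValue n m 2 + m * f n m := by
  simp only [midCont, thirdValue, f]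
  ring

lemma midCont_step (n m : ℕ) :
    ((m : ℝ) + 1) * midCont n m = m * midCont n (m + 1) + thirdValue n (m + 1) 2 := by
  simp only [midCont, thirdValue]
  push_cast
  ring

lemma lateCont_step {n m : ℕ} (hm : m ≠ 1) (hmn : m < n) :
    ((m : ℝ) + 1) * lateCont n m = (m - 1) * lateCont n (m + 1) + thirdValue n (m + 1) 2
      + thirdValue n (m + 1) 3 := by
  have : (m : ℝ) - 1 ≠ 0 := sub_ne_zero.2 (by exact_mod_cast hm)
  simp only [lateCont, thirdValue]
  rw [tailSum_eq_add hmn]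
  push_cast
  field_simp
  ring


lemma b_linear_bounds {n : ℕ} (hn : 32 ≤ n) :
    0.606 * ((n : ℝ) - 1) ≤ b n - 1 ∧ (b n : ℝ) - 3 < 0.607 * (n - 2) := by
  have hn' : (32 : ℝ) ≤ n := by exact_mod_cast hn
  obtain ⟨h1, h2⟩ := d₂_bounds
  have h3 := le_b (n := n) (by omega)
  have h4 := b_lt (n := n) (by omega)
  constructor <;> nlinarith

lemma nineteen_le_b {n : ℕ} (hn : 32 ≤ n) : 19 ≤ b n := by
  have hn' : (32 : ℝ) ≤ n := by exact_mod_cast hn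
  have h := (b_linear_bounds hn).1
  have : (19 : ℝ) < b n + 1 := by linarith
  have : 19 < b n + 1 := by exact_mod_cast this
  omega

lemma tailSum_pred_b {n : ℕ} (hn : 32 ≤ n) :
    tailSum n (b n - 1) = 1 / ((b n : ℝ) - 2) + tailSum n (b n) := by
  have hb := nineteen_le_b hn
  have hbn := (b_mem (n := n) (by omega)).2.1
  rw [tailSum_eq_add (by omega), Nat.sub_add_cancel (by omega)]
  push_cast [Nat.cast_sub (by omega : 1 ≤ b n)]
  ring

lemma u_eq {n : ℕ} (hn : 32 ≤ n) :
    u n = ((b n : ℝ) - 2) * (2 * (n : ℝ) - 4) * tailSum n (b n - 1) := by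
  have hb := nineteen_le_b hn
  rw [u, tailSum, Nat.sub_add_cancel (by omega)]

lemma midCont_pred_b {n : ℕ} (hn : 32 ≤ n) : midCont n (b n - 1) = lateCont n (b n - 1) := by
  have hb := nineteen_le_b hn
  rw [midCont, lateCont, u_eq hn]
  push_cast [Nat.cast_sub (by omega : 1 ≤ b n)]
  ring

lemma f_le_of_le {n : ℕ} {x y : ℝ} (hxy : x ≤ y) (h : 3 * (x + y) ≤ 1 + 4 * n) : f n y ≤ f n x := by
  unfold f
  nlinarith [mul_nonneg (sub_nonneg.2 hxy) (sub_nonneg.2 h)]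

lemma f_pred_b_nonpos {n : ℕ} (hn : 32 ≤ n) : f n ((b n - 1 : ℕ) : ℝ) ≤ 0 := by
  have hn' : (32 : ℝ) ≤ n := by exact_mod_cast hn
  have hb := nineteen_le_b hn
  obtain ⟨h1, h2⟩ := b_linear_bounds hn
  have h3 := (b_mem (n := n) (by omega)).2.2
  have hb' : (19 : ℝ) ≤ b n := by exact_mod_cast hb
  have hpos : (0 : ℝ) < b n - 2 := by linarith
  have hf : f n ((b n - 1 : ℕ) : ℝ)
      = (b n - 2) * ((2 * n - 4) * tailSum n (b n - 1) - 3 * (n - b n + 1)) := by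
    rw [f, u_eq hn]
    push_cast [Nat.cast_sub (by omega : 1 ≤ b n)]
    ring
  rw [hf]
  refine mul_nonpos_of_nonneg_of_nonpos hpos.le ?_
  rw [tailSum_pred_b hn]
  have h4 : 1 / ((b n : ℝ) - 2) * (2 * n - 4) ≤ 3.6 := by
    rw [one_div_mul_eq_div, div_le_iff₀ hpos]
    linarith
  nlinarith

lemma a_le_pred_b {n : ℕ} (hn : 32 ≤ n) : a n ≤ b n - 1 := by
  have hb := nineteen_le_b hn
  have hbn := (b_mem (n := n) (by omega)).2.1
  exact Nat.sInf_le ⟨by omega, by omega, f_pred_b_nonpos hn⟩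

lemma a_mem {n : ℕ} (hn : 32 ≤ n) : 2 ≤ a n ∧ f n (a n) ≤ 0 := by
  have hb := nineteen_le_b hn
  have hbn := (b_mem (n := n) (by omega)).2.1
  have : a n ∈ {j : ℕ | 2 ≤ j ∧ j ≤ n ∧ f n (j : ℝ) ≤ 0} :=
    Nat.sInf_mem ⟨b n - 1, by omega, by omega, f_pred_b_nonpos hn⟩
  exact ⟨this.1, this.2.2⟩

lemma f_pos_of_lt_a {n m : ℕ} (hn : 32 ≤ n) (h2 : 2 ≤ m) (hm : m < a n) : 0 < f n m := by
  by_contra h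
  have hbn := (b_mem (n := n) (by omega)).2.1
  have ha := a_le_pred_b hn
  exact absurd (Nat.sInf_le (s := {j : ℕ | 2 ≤ j ∧ j ≤ n ∧ f n (j : ℝ) ≤ 0})
    ⟨h2, by omega, not_lt.1 h⟩) (not_le.2 hm)

lemma f_nonpos_of_le {n m : ℕ} (hn : 32 ≤ n) (h1 : a n ≤ m) (h2 : m ≤ b n - 1) :
    f n m ≤ 0 := by
  have hn' : (32 : ℝ) ≤ n := by exact_mod_cast hn
  have hb := nineteen_le_b hn
  have h3 := (b_linear_bounds hn).2
  have h4 : (m : ℝ) + 1 ≤ b n := by exact_mod_cast (by omega : m + 1 ≤ b n)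
  have h5 : (a n : ℝ) ≤ m := by exact_mod_cast h1
  exact (f_le_of_le h5 (by linarith)).trans (a_mem hn).2

lemma thirdCont_of_b_le {n m : ℕ} (h : b n ≤ m + 1) : thirdCont n m = lateCont n m := if_pos h

lemma thirdCont_of_mid {n m : ℕ} (hn : 32 ≤ n) (h1 : a n ≤ m + 1) (h2 : m + 1 ≤ b n) :
    thirdCont n m = midCont n m := by
  by_cases h : b n ≤ m + 1
  · rw [thirdCont_of_b_le h, ← Nat.sub_eq_of_eq_add (le_antisymm h h2), midCont_pred_b hn]
  · rw [thirdCont, if_neg h, if_pos h1]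

lemma thirdCont_of_le_a {n m : ℕ} (hn : 32 ≤ n) (h : m + 1 ≤ a n) :
    thirdCont n m = midCont n (a n - 1) := by
  have ha := a_le_pred_b hn
  have hb := nineteen_le_b hn
  by_cases h1 : a n ≤ m + 1
  · rw [thirdCont_of_mid hn h1 (by omega), ← Nat.sub_eq_of_eq_add (le_antisymm h1 h)]
  · rw [thirdCont, if_neg (by omega), if_neg h1]

lemma midCont_le_thirdValue {n m : ℕ} (hn : 32 ≤ n) (h1 : a n ≤ m) (h2 : m ≤ b n - 1) :
    midCont n m ≤ thirdValue n m 2 := by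
  rw [midCont_eq]
  have := mul_nonneg (m.cast_nonneg (α := ℝ)) (neg_nonneg.2 (f_nonpos_of_le hn h1 h2))
  linarith

/-- Before stage `b n` the continuation value is at least its value just before that stage. -/
lemma thirdCont_pred_b_le {n m : ℕ} (hn : 32 ≤ n) (hm : m ≤ b n - 1) :
    thirdCont n (b n - 1) ≤ thirdCont n m := by
  have ha := a_le_pred_b hn
  have ha2 := (a_mem hn).1
  have hb := nineteen_le_b hn
  have hmid : ∀ m, a n - 1 ≤ m → m ≤ b n - 1 → midCont n (b n - 1) ≤ midCont n m := by
    intro m h1 h2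
    induction h2 using Nat.decreasingInduction with
    | self => exact le_rfl
    | of_succ l hl ih =>
      refine (ih (by omega)).trans ?_
      have h3 := midCont_step n l
      have h4 := midCont_le_thirdValue (m := l + 1) hn (by omega) (by omega)
      have : ((l : ℝ) + 1) * midCont n (l + 1) ≤ ((l : ℝ) + 1) * midCont n l := by
        rw [h3]
        linarith
      exact le_of_mul_le_mul_left this (by positivity)
  rw [thirdCont_of_mid hn (by omega) (by omega)]
  by_cases h : m + 1 ≤ a n
  · rw [thirdCont_of_le_a hn h]
    exact hmid _ le_rfl (by omega)
  · rw [thirdCont_of_mid hn (by omega) (by omega)]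
    exact hmid _ (by omega) hm

lemma thirdValue_three_pred_b_le {n m : ℕ} (hn : 32 ≤ n) (hm : m ≤ b n - 1) :
    thirdValue n (b n - 1) 3 ≤ thirdCont n m := by
  refine le_trans ?_ (thirdCont_pred_b_le hn hm)
  have hn' : (32 : ℝ) ≤ n := by exact_mod_cast hn
  have hb := nineteen_le_b hn
  have hb' : (19 : ℝ) ≤ ((b n - 1 : ℕ) : ℝ) + 1 := by exact_mod_cast (by omega)
  rw [thirdCont_of_b_le (by omega), lateCont, thirdValue]
  have h := half_lt_tailSum (n := n) (j := b n - 1) (by omega) (by omega) (by omega)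
  refine mul_le_mul_of_nonneg_left ?_ (mul_nonneg (by linarith) (by linarith))
  nlinarith

/-- Relative rank `1` is never worth accepting. Before stage `b n` this is the inequality between
the arithmetic and geometric means applied to `2m`, `n - m` and `n - m - 1`. -/
lemma thirdValue_one_le {n m : ℕ} (hn : 32 ≤ n) (hm : m ≤ n) :
    thirdValue n m 1 ≤ thirdCont n m := by
  have hn' : (32 : ℝ) ≤ n := by exact_mod_cast hn
  have hb := nineteen_le_b hn
  obtain ⟨hb1, -⟩ := b_linear_bounds hn
  have hmn : (m : ℝ) ≤ n := by exact_mod_cast hm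
  by_cases h : b n ≤ m
  · have h1 := div_le_tailSum (n := n) (j := m) (by omega) hm
    rw [div_le_iff₀ (by linarith)] at h1
    have h2 : (b n : ℝ) ≤ m := by exact_mod_cast h
    rw [thirdCont_of_b_le (by omega), lateCont, thirdValue, mul_assoc, mul_assoc]
    refine mul_le_mul_of_nonneg_left ?_ m.cast_nonneg
    calc ((n : ℝ) - m) * (n - m - 1) ≤ (m - 1) * (n - m) := by nlinarith
      _ ≤ _ := mul_le_mul_of_nonneg_left (by linarith) (by linarith)
  · refine le_trans ?_ (thirdValue_three_pred_b_le (m := m) hn (by omega))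
    obtain ⟨c, hc⟩ : ∃ c, b n - 1 = c + 1 := ⟨b n - 2, by omega⟩
    have hcb : (b n : ℝ) = c + 2 := by exact_mod_cast (by omega : b n = c + 2)
    have hm0 : (0 : ℝ) ≤ m := m.cast_nonneg
    rw [hc]
    simp only [thirdValue]
    push_cast
    have amgm : 27 * ((m : ℝ) * (n - m) * (n - m - 1)) ≤ (2 * n - 1) ^ 3 / 2 := by
      have h1 : 0 ≤ ((n : ℝ) - 1 / 2 - 3 * m) ^ 2 * (4 * (n - 1 / 2) - 3 * m) :=
        mul_nonneg (sq_nonneg _) (by linarith)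
      nlinarith
    have hc1 : 0.55 * (n : ℝ) ≤ c := by linarith
    have hc2 : (0.55 * (n : ℝ)) * ((0.55 * n) ^ 2 - 1) ≤ c * (c ^ 2 - 1) := by
      have h1 : (0.55 * (n : ℝ)) ^ 2 ≤ c ^ 2 := pow_le_pow_left₀ (by linarith) hc1 2
      exact mul_le_mul hc1 (by linarith) (by nlinarith) (by linarith)
    have hcube : ((2 : ℝ) * n - 1) ^ 3 ≤ (2 * n) ^ 3 :=
      pow_le_pow_left₀ (by linarith) (by linarith) 3
    have hn3 : 32 ^ 2 * (n : ℝ) ≤ n ^ 3 := by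
      have : (32 : ℝ) ^ 2 ≤ n ^ 2 := pow_le_pow_left₀ (by norm_num) hn' 2
      nlinarith
    nlinarith

lemma thirdCont_nonneg {n m : ℕ} (hn : 32 ≤ n) (hm : m ≤ n) : 0 ≤ thirdCont n m := by
  refine le_trans ?_ (thirdValue_one_le hn hm)
  rcases hm.lt_or_eq with h | rfl
  · have : (m : ℝ) + 1 ≤ n := by exact_mod_cast h
    exact mul_nonneg (mul_nonneg m.cast_nonneg (by linarith)) (by linarith)
  · simp [thirdValue]

/-- From stage `b n` on relative rank `2` is worth accepting: while `3m ≤ 2n + 2` because the tail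
sum is at most `1/2`, later because it is at most `(n - m)/(m - 1)`. -/
lemma lateCont_le_two {n m : ℕ} (hn : 32 ≤ n) (h : b n ≤ m) (hm : m ≤ n) :
    lateCont n m ≤ thirdValue n m 2 := by
  have hn' : (32 : ℝ) ≤ n := by exact_mod_cast hn
  have hb := nineteen_le_b hn
  have hm19 : (19 : ℝ) ≤ m := by exact_mod_cast hb.trans h
  have hmn : (m : ℝ) ≤ n := by exact_mod_cast hm
  have hS := (tailSum_le_of_le (n := n) (by omega) h).trans (b_mem (n := n) (by omega)).2.2
  have key : (2 * (n : ℝ) - 4) * tailSum n m ≤ 3 * (n - m) := by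
    by_cases hc : 3 * (m : ℝ) ≤ 2 * n + 2
    · nlinarith
    · have h1 := tailSum_le_div (n := n) (j := m) (by omega) hm
      rw [le_div_iff₀ (by linarith)] at h1
      have h2 : 0 ≤ tailSum n m := le_trans
        (div_nonneg (by linarith) (by linarith)) (div_le_tailSum (by omega) hm)
      nlinarith
  rw [lateCont, thirdValue]
  have h3 : (0 : ℝ) ≤ m * (m - 1) := mul_nonneg (by linarith) (by linarith)
  nlinarith

lemma lateCont_le_three {n m : ℕ} (hn : 32 ≤ n) (h : b n ≤ m) :
    lateCont n m ≤ thirdValue n m 3 := by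
  have hn' : (32 : ℝ) ≤ n := by exact_mod_cast hn
  have hb := nineteen_le_b hn
  have hm19 : (19 : ℝ) ≤ m := by exact_mod_cast hb.trans h
  have hS := (tailSum_le_of_le (n := n) (by omega) h).trans (b_mem (n := n) (by omega)).2.2
  rw [lateCont, thirdValue]
  refine mul_le_mul_of_nonneg_left ?_ (mul_nonneg (by linarith) (by linarith))
  nlinarith

/-- Before stage `a n` relative rank `2` is not worth accepting, because its value increases up to
that stage. -/
lemma thirdValue_two_le_of_lt_a {n m : ℕ} (hn : 32 ≤ n) (hm : m < a n) :
    thirdValue n m 2 ≤ midCont n (a n - 1) := by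
  have hn' : (32 : ℝ) ≤ n := by exact_mod_cast hn
  have ha := a_le_pred_b hn
  have ha2 := (a_mem hn).1
  have hb := nineteen_le_b hn
  have hbn := (b_linear_bounds hn).2
  have hlast : thirdValue n (a n - 1) 2 ≤ midCont n (a n - 1) := by
    by_cases h : a n - 1 = 1
    · -- relative rank `2` at stage `1` has the value `0`
      refine le_trans (le_of_eq ?_)
        ((thirdCont_nonneg hn (Nat.zero_le n)).trans_eq (thirdCont_of_le_a hn (by omega)))
      simp [h, thirdValue]
    · rw [midCont_eq]
      have := f_pos_of_lt_a (m := a n - 1) hn (by omega) (by omega)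
      have : 0 ≤ ((a n - 1 : ℕ) : ℝ) * f n ((a n - 1 : ℕ) : ℝ) :=
        mul_nonneg (Nat.cast_nonneg _) this.le
      linarith
  refine le_trans ?_ hlast
  have hm' : m ≤ a n - 1 := by omega
  induction hm' using Nat.decreasingInduction with
  | self => exact le_rfl
  | of_succ l hl ih =>
    refine le_trans ?_ (ih (by omega))
    have hl0 : (0 : ℝ) ≤ l := l.cast_nonneg
    have h3 : (l : ℝ) + 3 ≤ b n := by exact_mod_cast (by omega : l + 3 ≤ b n)
    simp only [thirdValue]
    push_cast
    nlinarith [mul_nonneg hl0 (by linarith : (0 : ℝ) ≤ 2 * n - 3 * l - 1)]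

/-- The two-threshold rule is optimal for the third best candidate. -/
theorem tau3_optimal {n : ℕ} [NeZero n] (hn : 32 ≤ n) :
    tau3 n ∈ stoppingRules n ∧ successProb 3 (tau3 n) = p 3 n ∧
      p 3 n = midCont n (a n - 1) / (n * (n - 1) * (n - 2)) := by
  classical
  have hn' : (32 : ℝ) ≤ n := by exact_mod_cast hn
  have ha := a_le_pred_b hn
  have ha2 := (a_mem hn).1
  have hb := nineteen_le_b hn
  rw [← thirdCont_of_le_a (m := 0) hn (by omega), tau3_eq_firstRule]
  refine firstRule_optimal 3 (mul_pos (mul_pos (by linarith) (by linarith)) (by linarith))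
    (thirdValue n) (thirdCont n) ?_ ?_ ?_ ?_ ?_ ?_
  · rintro m - y h1 -
    rcases y with _ | _ | _ | _ | y
    · omega
    all_goals simp only [thirdValue]; push_cast; ring
  · rintro y h1 -
    rcases y with _ | _ | _ | _ | y
    · omega
    all_goals simp [thirdValue]
  · rw [thirdCont_of_b_le (by have := (b_mem (n := n) (by omega)).2.1; omega), lateCont,
      tailSum_self]
    ring
  · intro m hm
    refine Eq.trans ?_ (sum_range_accept (fun _ => Iff.rfl) (thirdValue n (m + 1))
      (thirdCont n (m + 1)) (M := m + 1) (by omega) (by omega)).symm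
    push_cast
    by_cases h1 : a n ≤ m + 1
    · rw [if_pos h1]
      by_cases h2 : b n ≤ m + 1
      · rw [if_pos h2, thirdCont_of_b_le h2, thirdCont_of_b_le (by omega),
          lateCont_step (by omega) hm]
        ring
      · rw [if_neg h2, thirdCont_of_mid hn h1 (by omega),
          thirdCont_of_mid hn (by omega) (by omega), midCont_step]
        ring
    · rw [if_neg h1, if_neg (by omega), thirdCont_of_le_a hn (by omega),
        thirdCont_of_le_a hn (by omega)]
      ring
  · rintro m r h1 h2 h3 (⟨h4, rfl⟩ | ⟨h4, rfl⟩)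
    · by_cases h5 : b n ≤ m
      · rw [thirdCont_of_b_le (by omega)]
        exact lateCont_le_two hn h5 h3
      · rw [thirdCont_of_mid hn (by omega) (by omega)]
        exact midCont_le_thirdValue hn h4 (by omega)
    · rw [thirdCont_of_b_le (by omega)]
      exact lateCont_le_three hn h4
  · intro m r h1 h2 h3 h4
    rcases r with _ | _ | _ | _ | r
    · omega
    · exact thirdValue_one_le hn h3
    · have h5 : m < a n := by
        by_contra hc
        exact h4 (Or.inl ⟨by omega, rfl⟩)
      rw [thirdCont_of_le_a hn h5]
      exact thirdValue_two_le_of_lt_a hn h5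
    · have h5 : m < b n := by
        by_contra hc
        exact h4 (Or.inr ⟨by omega, rfl⟩)
      refine le_trans ?_ (thirdValue_three_pred_b_le hn (by omega))
      have h6 : (3 : ℝ) ≤ m := by exact_mod_cast h2
      have h7 : (m : ℝ) ≤ ((b n - 1 : ℕ) : ℝ) := by exact_mod_cast (by omega : m ≤ b n - 1)
      simp only [thirdValue]
      exact mul_le_mul (mul_le_mul h7 (by linarith) (by linarith) (by linarith)) (by linarith)
        (by linarith) (mul_nonneg (by linarith) (by linarith))
    · exact thirdCont_nonneg hn h3

/-- The optimal value lies between the values of relative rank `2` at stages `a n - 1` and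
`a n`. -/
lemma p_three_bounds {n : ℕ} (hn : 32 ≤ n) :
    thirdValue n (a n - 1) 2 / (n * (n - 1) * (n - 2)) ≤ p 3 n ∧
      p 3 n ≤ thirdValue n (a n) 2 / (n * (n - 1) * (n - 2)) := by
  have : NeZero n := ⟨by omega⟩
  have hn' : (32 : ℝ) ≤ n := by exact_mod_cast hn
  have ha2 := (a_mem hn).1
  have hpos : (0 : ℝ) < n * (n - 1) * (n - 2) :=
    mul_pos (mul_pos (by linarith) (by linarith)) (by linarith)
  rw [(tau3_optimal hn).2.2, div_le_div_iff_of_pos_right hpos, div_le_div_iff_of_pos_right hpos]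
  refine ⟨thirdValue_two_le_of_lt_a hn (by omega), ?_⟩
  obtain ⟨c, hc⟩ : ∃ c, a n = c + 1 := ⟨a n - 1, by omega⟩
  have h1 := midCont_step n c
  have h2 := midCont_le_thirdValue (m := a n) hn le_rfl (a_le_pred_b hn)
  rw [hc] at h2 ⊢
  rw [Nat.add_sub_cancel]
  have h3 := mul_le_mul_of_nonneg_left h2 c.cast_nonneg (α := ℝ)
  have : ((c : ℝ) + 1) * midCont n c ≤ ((c : ℝ) + 1) * thirdValue n (c + 1) 2 := by linarith
  exact le_of_mul_le_mul_left this (by positivity)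

/-! ### The limiting constants -/

lemma d₁_root : 3 * d₁ ^ 2 - 4 * d₁ + 2 * d₂ = 0 := by
  obtain ⟨h1, -⟩ := sqrt_exp_one_bounds
  have hs : √(Real.exp 1) ^ 2 = Real.exp 1 := Real.sq_sqrt (Real.exp_pos 1).le
  rw [d₁, d₂, ← hs, Real.sqrt_sq (Real.sqrt_nonneg _)]
  set s := √(Real.exp 1)
  have ht : √(4 * s ^ 2 - 6 * s) ^ 2 = 4 * s ^ 2 - 6 * s := Real.sq_sqrt (by nlinarith)
  have ht0 := Real.sqrt_nonneg (4 * s ^ 2 - 6 * s)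
  set t := √(4 * s ^ 2 - 6 * s)
  have hs0 : s ≠ 0 := by linarith
  have hD : 2 * s + t ≠ 0 := by linarith
  field_simp
  linear_combination 2 * ht

lemma d₁_bounds : 0.4663 ≤ d₁ ∧ d₁ < 0.4666 := by
  obtain ⟨h1, h2⟩ := sqrt_exp_one_bounds
  have h3 := Real.exp_one_gt_d9
  have h4 := Real.exp_one_lt_d9
  have h5 : 0.99 ≤ √(4 * Real.exp 1 - 6 * √(Real.exp 1)) := by
    apply Real.le_sqrt_of_sq_le
    norm_num at *
    linarith
  have h6 : √(4 * Real.exp 1 - 6 * √(Real.exp 1)) ≤ 0.9906 := by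
    rw [Real.sqrt_le_left (by norm_num)]
    norm_num at *
    linarith
  rw [d₁]
  constructor
  · rw [le_div_iff₀ (by linarith)]
    linarith
  · rw [div_lt_iff₀ (by linarith)]
    linarith

lemma limit_value_bounds :
    0.232 ≤ 2 * d₁ ^ 2 * (1 - d₁) ∧ 2 * d₁ ^ 2 * (1 - d₁) < 0.233 := by
  obtain ⟨h1, h2⟩ := d₁_bounds
  have h3 : 0.4663 ^ 2 ≤ d₁ ^ 2 := pow_le_pow_left₀ (by norm_num) h1 2
  have h4 : d₁ ^ 2 ≤ 0.4666 ^ 2 := pow_le_pow_left₀ (by linarith) h2.le 2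
  constructor <;> nlinarith

lemma limit_value_eq : 2 * d₁ ^ 2 * (1 - d₁) =
    8 * (2 * √(Real.exp 1) - 2 + √(4 * Real.exp 1 - 6 * √(Real.exp 1))) /
      (2 * √(Real.exp 1) + √(4 * Real.exp 1 - 6 * √(Real.exp 1))) ^ 3 := by
  obtain ⟨h1, -⟩ := sqrt_exp_one_bounds
  have ht0 := Real.sqrt_nonneg (4 * Real.exp 1 - 6 * √(Real.exp 1))
  rw [d₁]
  have hD : 2 * √(Real.exp 1) + √(4 * Real.exp 1 - 6 * √(Real.exp 1)) ≠ 0 := by linarith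
  field_simp
  ring

/-! ### Limits -/

/-- A sequence at bounded distance from `d * n` has `d` as the limit of its ratio to `n`. -/
lemma tendsto_div_of_abs_sub_le {c : ℕ → ℝ} {d C : ℝ} {n₀ : ℕ}
    (h : ∀ n, n₀ ≤ n → |c n - d * n| ≤ C) : Tendsto (fun n : ℕ => c n / n) atTop (𝓝 d) := by
  rw [tendsto_iff_norm_sub_tendsto_zero]
  refine squeeze_zero' (Eventually.of_forall fun _ => norm_nonneg _) ?_
    (tendsto_const_div_atTop_nhds_zero_nat C)
  filter_upwards [eventually_ge_atTop n₀, eventually_gt_atTop 0] with n hn hn0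
  have hpos : (0 : ℝ) < n := by exact_mod_cast hn0
  rw [Real.norm_eq_abs, le_div_iff₀ hpos, ← abs_of_pos hpos, ← abs_mul, abs_of_pos hpos, sub_mul,
    div_mul_cancel₀ _ hpos.ne']
  exact h n hn

lemma tendsto_b_div : Tendsto (fun n : ℕ => (b n : ℝ) / (n : ℝ)) atTop (𝓝 d₂) := by
  refine tendsto_div_of_abs_sub_le (C := 3) (n₀ := 32) fun n hn => ?_
  obtain ⟨h1, h2⟩ := d₂_bounds
  have h3 := le_b (n := n) (by omega)
  have h4 := b_lt (n := n) (by omega)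
  rw [abs_le]
  constructor <;> linarith

/-- The polynomial `f n` is `3x² - 4nx + 2 d₂ n²` up to an error of order `n`. -/
lemma abs_f_sub_le {n : ℕ} (hn : 32 ≤ n) {x : ℝ} (h0 : 0 ≤ x) (hx : x ≤ n) :
    |f n x - (3 * x ^ 2 - 4 * n * x + 2 * d₂ * n ^ 2)| ≤ 8 * (n : ℝ) := by
  have hn' : (32 : ℝ) ≤ n := by exact_mod_cast hn
  have hb := nineteen_le_b hn
  have hb' : (19 : ℝ) ≤ b n := by exact_mod_cast hb
  obtain ⟨h1, h2⟩ := d₂_bounds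
  have h3 := le_b (n := n) (by omega)
  have h4 := b_lt (n := n) (by omega)
  have h5 := half_lt_tailSum (n := n) (j := b n - 1) (by omega) (by omega) (by omega)
  have h6 := (b_mem (n := n) (by omega)).2.2
  have h7 := tailSum_pred_b hn
  have hu1 : (b n - 2) * ((n : ℝ) - 2) ≤ u n := by
    rw [u_eq hn]
    have : (0 : ℝ) ≤ (b n - 2) * (n - 2) := mul_nonneg (by linarith) (by linarith)
    nlinarith
  have hu2 : u n ≤ (b n - 2) * ((n : ℝ) - 2) + (2 * n - 4) := by
    have he : u n = (b n - 2) * (2 * (n : ℝ) - 4) * tailSum n (b n) + (2 * n - 4) := by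
      have : (b n : ℝ) - 2 ≠ 0 := by linarith
      rw [u_eq hn, h7]
      field_simp
      ring
    rw [he]
    have : (0 : ℝ) ≤ (b n - 2) * (n - 2) := mul_nonneg (by linarith) (by linarith)
    nlinarith
  have hb1 : ((n : ℝ) - 2) * (d₂ * (n - 1) + 1) ≤ (n - 2) * b n :=
    mul_le_mul_of_nonneg_left (by linarith) (by linarith)
  have hb2 : ((n : ℝ) - 2) * b n ≤ (n - 2) * (d₂ * (n - 2) + 3) :=
    mul_le_mul_of_nonneg_left (by linarith) (by linarith)
  have hd1 : d₂ * n ≤ 0.607 * n := mul_le_mul_of_nonneg_right h2.le (by linarith)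
  have hd2 : 0 ≤ d₂ * (n : ℝ) := mul_nonneg (by linarith) (by linarith)
  rw [abs_le, f]
  constructor <;> nlinarith

lemma three_le_a {n : ℕ} (hn : 32 ≤ n) : 3 ≤ a n := by
  obtain ⟨h2, hf⟩ := a_mem hn
  by_contra h
  have ha : a n = 2 := by omega
  have hn' : (32 : ℝ) ≤ n := by exact_mod_cast hn
  have hb := nineteen_le_b hn
  have hb' : (19 : ℝ) ≤ b n := by exact_mod_cast hb
  have h5 := half_lt_tailSum (n := n) (j := b n - 1) (by omega) (by omega) (by omega)
  have hu : 0 ≤ u n := by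
    rw [u_eq hn]
    exact mul_nonneg (mul_nonneg (by linarith) (by linarith)) (by linarith)
  rw [ha, f] at hf
  push_cast at hf
  nlinarith

/-- The factorization `3(x - d₁ n)(x - (4/3 - d₁) n)` of the leading part of `f n`, together with
the change of sign of `f n` between `a n - 1` and `a n`. -/
lemma abs_a_sub_le {n : ℕ} (hn : 32 ≤ n) : |(a n : ℝ) - d₁ * n| ≤ 15 := by
  have hn' : (32 : ℝ) ≤ n := by exact_mod_cast hn
  have ha3 := three_le_a hn
  have hb := nineteen_le_b hn
  have hbn := (b_linear_bounds hn).2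
  obtain ⟨c, hc⟩ : ∃ c, a n = c + 1 := ⟨a n - 1, by omega⟩
  have hac : (a n : ℝ) = c + 1 := by exact_mod_cast hc
  have hab : (c : ℝ) + 2 ≤ b n := by
    exact_mod_cast (by have := a_le_pred_b hn; omega : c + 2 ≤ b n)
  have hc0 : (0 : ℝ) ≤ c := c.cast_nonneg
  have hroot := d₁_root
  obtain ⟨h1, h2⟩ := d₁_bounds
  have hfac : ∀ x : ℝ, 3 * x ^ 2 - 4 * n * x + 2 * d₂ * n ^ 2
      = 3 * (d₁ * n - x) * ((4 / 3 - d₁) * n - x) := fun x => by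
    linear_combination (n : ℝ) ^ 2 * hroot
  have hgap : 0.2 * (n : ℝ) ≤ (4 / 3 - d₁) * n - (c + 1) := by nlinarith
  have hA := (a_mem hn).2
  have hC := f_pos_of_lt_a (m := c) hn (by omega) (by omega)
  have eA := (abs_le.1 (abs_f_sub_le hn (x := a n) (by linarith) (by linarith))).1
  have eC := (abs_le.1 (abs_f_sub_le hn (x := c) (by linarith) (by linarith))).2
  rw [hfac] at eA eC
  rw [hac] at eA hA
  rw [abs_le, hac]
  constructor
  · by_contra! hlt
    have : 15 * (0.2 * (n : ℝ)) ≤ (d₁ * n - (c + 1)) * ((4 / 3 - d₁) * n - (c + 1)) :=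
      mul_le_mul (by linarith) hgap (by linarith) (by linarith)
    linarith
  · by_contra! hlt
    have : 14 * (0.2 * (n : ℝ)) ≤ (c - d₁ * n) * ((4 / 3 - d₁) * n - c) :=
      mul_le_mul (by linarith) (by linarith) (by linarith) (by linarith)
    linarith

lemma tendsto_a_div : Tendsto (fun n : ℕ => (a n : ℝ) / (n : ℝ)) atTop (𝓝 d₁) :=
  tendsto_div_of_abs_sub_le fun _ hn => abs_a_sub_le hn

lemma tendsto_pred_a_div :
    Tendsto (fun n : ℕ => ((a n - 1 : ℕ) : ℝ) / (n : ℝ)) atTop (𝓝 d₁) := by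
  refine tendsto_div_of_abs_sub_le (C := 16) (n₀ := 32) fun n hn => ?_
  have h := abs_le.1 (abs_a_sub_le hn)
  have := three_le_a hn
  push_cast [Nat.cast_sub (by omega : 1 ≤ a n)]
  rw [abs_le]
  constructor <;> linarith [h.1, h.2]

/-- The value of relative rank `2` at a stage asymptotic to `x n`. -/
lemma tendsto_thirdValue_two {c : ℕ → ℕ} {x : ℝ}
    (hc : Tendsto (fun n : ℕ => (c n : ℝ) / n) atTop (𝓝 x)) :
    Tendsto (fun n : ℕ => thirdValue n (c n) 2 / ((n : ℝ) * (n - 1) * (n - 2))) atTop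
      (𝓝 (2 * x ^ 2 * (1 - x))) := by
  have h1 := tendsto_const_div_atTop_nhds_zero_nat (1 : ℝ)
  have h2 := tendsto_const_div_atTop_nhds_zero_nat (2 : ℝ)
  have hlim : Tendsto (fun n : ℕ => 2 * ((c n : ℝ) / n) * ((c n : ℝ) / n - 1 / n)
      * (1 - (c n : ℝ) / n) / ((1 - 1 / (n : ℝ)) * (1 - 2 / (n : ℝ)))) atTop
      (𝓝 (2 * x * (x - 0) * (1 - x) / ((1 - 0) * (1 - 0)))) :=
    (((hc.const_mul 2).mul (hc.sub h1)).mul (hc.const_sub 1)).div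
      ((h1.const_sub 1).mul (h2.const_sub 1)) (by norm_num)
  have heq : 2 * x * (x - 0) * (1 - x) / ((1 - 0) * (1 - 0)) = 2 * x ^ 2 * (1 - x) := by
    rw [sub_zero, sub_zero, mul_one, div_one]
    ring
  rw [heq] at hlim
  refine hlim.congr' ?_
  filter_upwards [eventually_ge_atTop 3] with n hn
  have hn' : (3 : ℝ) ≤ n := by exact_mod_cast hn
  have e0 : (n : ℝ) ≠ 0 := by linarith
  have e1 : (n : ℝ) - 1 ≠ 0 := by linarith
  have e2 : (n : ℝ) - 2 ≠ 0 := by linarith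
  simp only [thirdValue]
  field_simp

lemma tendsto_p_three :
    Tendsto (fun n : ℕ => p 3 n) atTop (𝓝 (2 * d₁ ^ 2 * (1 - d₁))) := by
  refine tendsto_of_tendsto_of_tendsto_of_le_of_le' (tendsto_thirdValue_two tendsto_pred_a_div)
    (tendsto_thirdValue_two tendsto_a_div) ?_ ?_
  · filter_upwards [eventually_ge_atTop 32] with n hn using (p_three_bounds hn).1
  · filter_upwards [eventually_ge_atTop 32] with n hn using (p_three_bounds hn).2

end KthBest

theorem mainTheorem5 :
    -- the normalised thresholds converge
    Tendsto (fun n : ℕ => (KthBest.a n : ℝ) / (n : ℝ)) atTop (𝓝 KthBest.d₁) ∧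
    Tendsto (fun n : ℕ => (KthBest.b n : ℝ) / (n : ℝ)) atTop (𝓝 KthBest.d₂) ∧
    (0.466 ≤ KthBest.d₁ ∧ KthBest.d₁ < 0.467) ∧
    (0.606 ≤ KthBest.d₂ ∧ KthBest.d₂ < 0.607) ∧
    -- the two-threshold rule attains the maximum probability
    (∀ (n : ℕ) [NeZero n], 32 ≤ n →
      KthBest.tau3 n ∈ KthBest.stoppingRules n ∧
        KthBest.successProb 3 (KthBest.tau3 n) = KthBest.p 3 n) ∧
    -- the limiting maximum probability for the third best candidate
    Tendsto (fun n : ℕ => KthBest.p 3 n) atTop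
      (𝓝 (2 * KthBest.d₁ ^ 2 * (1 - KthBest.d₁))) ∧
    2 * KthBest.d₁ ^ 2 * (1 - KthBest.d₁) =
      8 * (2 * √(Real.exp 1) - 2 + √(4 * Real.exp 1 - 6 * √(Real.exp 1))) /
        (2 * √(Real.exp 1) + √(4 * Real.exp 1 - 6 * √(Real.exp 1))) ^ 3 ∧
    (0.232 ≤ 2 * KthBest.d₁ ^ 2 * (1 - KthBest.d₁) ∧
      2 * KthBest.d₁ ^ 2 * (1 - KthBest.d₁) < 0.233) ∧
    -- comparison with the second best candidate
    Tendsto (fun n : ℕ => KthBest.p 2 n) atTop (𝓝 (1 / 4)) ∧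
    2 * KthBest.d₁ ^ 2 * (1 - KthBest.d₁) < 1 / 4 := by
  obtain ⟨h1, h2⟩ := KthBest.d₁_bounds
  obtain ⟨h3, h4⟩ := KthBest.limit_value_bounds
  exact ⟨KthBest.tendsto_a_div, KthBest.tendsto_b_div, ⟨by linarith, by linarith⟩,
    KthBest.d₂_bounds,
    fun n _ hn => ⟨(KthBest.tau3_optimal hn).1, (KthBest.tau3_optimal hn).2.1⟩,
    KthBest.tendsto_p_three, KthBest.limit_value_eq, ⟨h3, h4⟩, KthBest.tendsto_p_two,
    by linarith⟩
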